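/- Let $p>3$ be a prime, let $s$ and $d$ be positive integers with $p\nmid d$, let $r$ be an integer with $\gcd(r,d)=1$, and let $m$ be the least nonnegative residue of $-r/d$ modulo $p^s$. Then, for $M=p^s-1$ and for $M=m$, $$\sum_{k=0}^{M}(-1)^k(2dk+r)\frac{\left(\frac{r}{d}\right)_k^3}{k!^3}\equiv(-1)^m(md+r)+\frac{2(-1)^m(md+r)^3}{d^2}\sum_{k=1}^{m}\frac{(-1)^k}{k^2}\pmod{p^{s+3}}.$$ Here $(x)_k=x(x+1)\cdots(x+k-1)$, with $(x)_0=1$, denotes the Pochhammer symbol. For rational numbers $x,y$ and a nonnegative integer $N$, $x\equiv y\pmod{p^N}$ means that $x-y=p^Nz$ for a rational number $z$ whose denominator in lowest terms is not divisible by $p$. The least nonnegative residue of a rational number $x$ modulo $p^s$ is the least nonnegative integer congruent to $x$ modulo $p^s$. -/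

import Mathlib

/-- Congruence of rational numbers modulo `p ^ N`: the difference `x - y` is `p ^ N` times a
rational number whose (reduced) denominator is not divisible by `p`. -/
def RatModEq (p N : ℕ) (x y : ℚ) : Prop :=
  ∃ z : ℚ, ¬ p ∣ z.den ∧ x - y = (p : ℚ) ^ N * z

/-- `m` is the least nonnegative residue of the rational number `x` modulo `p ^ N`: the least
natural number that is congruent to `x` modulo `p ^ N`. -/
def IsLeastNonnegResidue (p N : ℕ) (x : ℚ) (m : ℕ) : Prop :=
  IsLeast {j : ℕ | RatModEq p N (j : ℚ) x} m

/-- The Pochhammer symbol `(x)_k = x (x + 1) ⋯ (x + k - 1)`. -/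
def pochhammerSymbol (x : ℚ) (k : ℕ) : ℚ :=
  ∏ i ∈ Finset.range k, (x + (i : ℚ))

/-! Put x = r/d and t = x + m, a multiple of p^s. Divide the sum by d and deform it to S(w),
replacing (x)_k^2 / k!^2 by ∏((x+i)^2 - w) / ∏(i^2 - w); the target is S(0). Whipple's
transformation (`wellPoisedSum_eq`) gives S(w) = P·R(w), with P free of w and R(w) a terminating
₃F₂. At w = t^2 the series stops at k = m and equals (-1)^m t (`wellPoisedSum_sq`). Writing P = t c,
this says c R(t^2) = (-1)^m, whence S(0) = (-1)^m t - t c (R(t^2) - R(0)). Modulo p the terms of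
R(0) reduce to E(m,j) = (-1)^j C(m,j) C(m+j,j) (`dualSum_term_congr`), and ∑ E(m,j) = (-1)^m, so c ≡
1 mod p. Expanding the denominators in t^2 gives R(t^2) - R(0) ≡ t^2 H mod p^3, where H weights
E(m,j) by harmonic numbers of order two; `legendreCoeff_harmonic_sum` evaluates H. -/

open Finset

/-! ### Rising factorials and Chu–Vandermonde -/

lemma pochhammerSymbol_zero (x : ℚ) : pochhammerSymbol x 0 = 1 := by
  simp [pochhammerSymbol]

lemma pochhammerSymbol_succ (x : ℚ) (k : ℕ) :
    pochhammerSymbol x (k + 1) = pochhammerSymbol x k * (x + k) := by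
  simp [pochhammerSymbol, prod_range_succ]

lemma pochhammerSymbol_succ_left (x : ℚ) (k : ℕ) :
    pochhammerSymbol x (k + 1) = x * pochhammerSymbol (x + 1) k := by
  simp only [pochhammerSymbol, prod_range_succ', Nat.cast_zero, add_zero]
  rw [mul_comm]
  congr 1
  refine prod_congr rfl fun i _ => ?_
  push_cast
  ring

lemma pochhammerSymbol_shift (x : ℚ) (k : ℕ) :
    x * pochhammerSymbol (x + 1) k = pochhammerSymbol x k * (x + k) := by
  rw [← pochhammerSymbol_succ_left, pochhammerSymbol_succ]

lemma pochhammerSymbol_add (x : ℚ) (k l : ℕ) :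
    pochhammerSymbol x (k + l) = pochhammerSymbol x k * pochhammerSymbol (x + k) l := by
  induction l with
  | zero => simp [pochhammerSymbol_zero]
  | succ l ih =>
    rw [← add_assoc, pochhammerSymbol_succ, ih, pochhammerSymbol_succ]
    push_cast
    ring

lemma pochhammerSymbol_eq_zero {x : ℚ} {i k : ℕ} (hx : x + i = 0) (h : i < k) :
    pochhammerSymbol x k = 0 :=
  prod_eq_zero (mem_range.2 h) hx

lemma pochhammerSymbol_one (k : ℕ) : pochhammerSymbol 1 k = k.factorial := by
  induction k with
  | zero => simp [pochhammerSymbol_zero]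
  | succ k ih =>
    rw [pochhammerSymbol_succ, ih, Nat.factorial_succ]
    push_cast
    ring

lemma pochhammerSymbol_reflect (x : ℚ) (k : ℕ) :
    pochhammerSymbol x k = (-1) ^ k * pochhammerSymbol (1 - x - k) k := by
  induction k generalizing x with
  | zero => simp [pochhammerSymbol_zero]
  | succ k ih =>
    rw [pochhammerSymbol_succ, ih, pochhammerSymbol_succ_left]
    push_cast
    rw [show 1 - x - (k + 1) + 1 = 1 - x - (k : ℚ) by ring]
    ring

lemma pochhammerSymbol_neg_mul_factorial {m j : ℕ} (h : j ≤ m) :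
    pochhammerSymbol (-m) j * (m - j).factorial = (-1) ^ j * m.factorial := by
  induction j with
  | zero => simp [pochhammerSymbol_zero]
  | succ j ih =>
    have h' : m - j = (m - (j + 1)) + 1 := by omega
    have hc : ((m - (j + 1) : ℕ) : ℚ) = m - (j + 1) := by
      rw [Nat.cast_sub h]
      push_cast
      ring
    have := ih (by omega)
    rw [h', Nat.factorial_succ] at this
    push_cast [hc] at this
    rw [pochhammerSymbol_succ, pow_succ]
    linear_combination -this

/-- Turns the Vandermonde identity for generalised binomials into one for rising factorials. -/
lemma ringChoose_neg (z : ℚ) (k : ℕ) :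
    Ring.choose (-z) k = (-1) ^ k * (pochhammerSymbol z k / k.factorial) := by
  have h := Ring.descPochhammer_eq_factorial_smul_choose (-z) k
  have hs : ∀ k : ℕ, (descPochhammer ℤ k).smeval (-z) = (-1) ^ k * pochhammerSymbol z k := by
    intro k
    induction k with
    | zero => simp [pochhammerSymbol_zero]
    | succ k ih =>
      rw [descPochhammer_succ_right, Polynomial.smeval_mul, ih, pochhammerSymbol_succ]
      simp [Polynomial.smeval_sub, Polynomial.smeval_natCast]
      ring
  rw [hs, nsmul_eq_mul] at h
  have hk : (k.factorial : ℚ) ≠ 0 := by exact_mod_cast k.factorial_ne_zero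
  field_simp
  linear_combination -h

/-- The Chu–Vandermonde convolution for rising factorials. -/
lemma pochhammerSymbol_vandermonde (a b : ℚ) (n : ℕ) :
    pochhammerSymbol (a + b) n / n.factorial =
      ∑ i ∈ range (n + 1), pochhammerSymbol a i / i.factorial *
        (pochhammerSymbol b (n - i) / (n - i).factorial) := by
  have h := Ring.add_choose_eq (r := -a) (s := -b) n (Commute.all _ _)
  rw [show -a + -b = -(a + b) by ring, ringChoose_neg,
    Nat.sum_antidiagonal_eq_sum_range_succ_mk] at h
  have h1 : ((-1 : ℚ) ^ n) * (-1) ^ n = 1 := by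
    rw [← mul_pow]
    norm_num
  have h2 := congrArg (fun z => (-1 : ℚ) ^ n * z) h
  simp only [← mul_assoc, h1, one_mul] at h2
  rw [h2, mul_sum]
  refine sum_congr rfl fun i hi => ?_
  have hi' : i + (n - i) = n := by
    have := mem_range.1 hi
    omega
  rw [ringChoose_neg, ringChoose_neg]
  have h3 : (-1 : ℚ) ^ i * (-1) ^ (n - i) = (-1) ^ n := by rw [← pow_add, hi']
  linear_combination (pochhammerSymbol a i / i.factorial *
        (pochhammerSymbol b (n - i) / (n - i).factorial)) * ((-1) ^ n * h3 + h1)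

/-! ### The deformed series: Saalschütz and Whipple -/

/-- The product `∏_{i = 1}^{k} (i² - w)`. -/
def shiftedSqProd (w : ℚ) (k : ℕ) : ℚ :=
  ∏ i ∈ range k, (((i : ℚ) + 1) ^ 2 - w)

/-- The product `∏_{i = 0}^{k - 1} ((x + i)² - w)`. -/
def shiftedSqPochhammer (x w : ℚ) (k : ℕ) : ℚ :=
  ∏ i ∈ range k, ((x + i) ^ 2 - w)

lemma shiftedSqProd_zero_right (w : ℚ) : shiftedSqProd w 0 = 1 := by simp [shiftedSqProd]

lemma shiftedSqProd_succ (w : ℚ) (k : ℕ) :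
    shiftedSqProd w (k + 1) = shiftedSqProd w k * (((k : ℚ) + 1) ^ 2 - w) := by
  simp [shiftedSqProd, prod_range_succ]

lemma shiftedSqProd_zero (k : ℕ) : shiftedSqProd 0 k = (k.factorial : ℚ) ^ 2 := by
  induction k with
  | zero => simp [shiftedSqProd]
  | succ k ih =>
    rw [shiftedSqProd_succ, ih, Nat.factorial_succ]
    push_cast
    ring

lemma shiftedSqProd_sq (t : ℚ) (k : ℕ) :
    shiftedSqProd (t ^ 2) k = pochhammerSymbol (1 - t) k * pochhammerSymbol (1 + t) k := by
  simp only [shiftedSqProd, pochhammerSymbol, ← prod_mul_distrib]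
  exact prod_congr rfl fun i _ => by ring

lemma shiftedSqPochhammer_zero (x : ℚ) (k : ℕ) :
    shiftedSqPochhammer x 0 k = pochhammerSymbol x k ^ 2 := by
  simp [shiftedSqPochhammer, pochhammerSymbol, prod_pow]

lemma shiftedSqPochhammer_succ (x w : ℚ) (k : ℕ) :
    shiftedSqPochhammer x w (k + 1) = shiftedSqPochhammer x w k * ((x + k) ^ 2 - w) := by
  simp [shiftedSqPochhammer, prod_range_succ]

lemma shiftedSqPochhammer_eq_zero {x t : ℚ} {m k : ℕ} (ht : x + m = t) (h : m < k) :
    shiftedSqPochhammer x (t ^ 2) k = 0 :=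
  prod_eq_zero (mem_range.2 h) (by rw [ht, sub_self])

/-- The summand of the terminating Saalschützian series. -/
def saalschutzTerm (x w : ℚ) (k j : ℕ) : ℚ :=
  pochhammerSymbol (-k) j * pochhammerSymbol (x + k) j * pochhammerSymbol (1 - x) j /
    (j.factorial * shiftedSqProd w j)

/-- A Gosper-type antidifference in j for the first-order recurrence in k satisfied by the
Saalschütz sum. The disjunction in `hw` asks for nonzero denominators only up to J: for w = t^2 with
t a nonzero integer, later ones vanish. -/
lemma saalschutzTerm_telescope (x w : ℚ) (k J : ℕ) (hw : ∀ i : ℕ, shiftedSqProd w i ≠ 0 ∨ J < i) :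
    ∑ j ∈ range (J + 1), ((((k : ℚ) + 1) ^ 2 - w) * saalschutzTerm x w (k + 1) j -
        ((x + k) ^ 2 - w) * saalschutzTerm x w k j) =
      (2 * k + 1 + x) * (pochhammerSymbol (-k) J * pochhammerSymbol (x + k + 1) J *
        pochhammerSymbol (1 - x) (J + 1) / (J.factorial * shiftedSqProd w J)) := by
  induction J with
  | zero =>
    simp [saalschutzTerm, pochhammerSymbol_zero, shiftedSqProd_zero_right, pochhammerSymbol_succ]
    ring
  | succ J ih =>
    rw [sum_range_succ, ih fun i => (hw i).imp_right (by omega)]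
    have h1 : shiftedSqProd w (J + 1) ≠ 0 := by simpa using hw (J + 1)
    rw [shiftedSqProd_succ] at h1
    have h2 := left_ne_zero_of_mul h1
    have h3 := right_ne_zero_of_mul h1
    have h4 : (J.factorial : ℚ) ≠ 0 := by exact_mod_cast J.factorial_ne_zero
    have h5 : (J : ℚ) + 1 ≠ 0 := by positivity
    have e1 : pochhammerSymbol (-((k + 1 : ℕ) : ℚ)) (J + 1) =
        -(k + 1) * pochhammerSymbol (-k) J := by
      rw [pochhammerSymbol_succ_left]
      push_cast
      rw [show -((k : ℚ) + 1) + 1 = -k by ring]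
    have e2 : pochhammerSymbol (x + ((k + 1 : ℕ) : ℚ)) (J + 1) =
        pochhammerSymbol (x + k + 1) J * (x + k + 1 + J) := by
      rw [← pochhammerSymbol_succ]
      push_cast
      rw [add_assoc]
    have e3 : pochhammerSymbol (x + k) (J + 1) = (x + k) * pochhammerSymbol (x + k + 1) J :=
      pochhammerSymbol_succ_left _ _
    simp only [saalschutzTerm]
    rw [e1, e2, e3, pochhammerSymbol_succ (1 - x) (J + 1), pochhammerSymbol_succ (x + k + 1) J,
      pochhammerSymbol_succ (-k : ℚ) J, shiftedSqProd_succ, Nat.factorial_succ]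
    push_cast
    field_simp
    ring

/-- The terminating Pfaff–Saalschütz summation, in the specialisation needed for the
well-poised series. -/
lemma saalschutz_sum (x w : ℚ) (n : ℕ) (hw : ∀ i : ℕ, shiftedSqProd w i ≠ 0 ∨ n < i) :
    ∀ k ≤ n, ∑ j ∈ range (n + 1), saalschutzTerm x w k j =
      shiftedSqPochhammer x w k / shiftedSqProd w k := by
  intro k
  induction k with
  | zero =>
    intro _
    rw [sum_eq_single 0]
    · simp [saalschutzTerm, pochhammerSymbol_zero, shiftedSqProd, shiftedSqPochhammer]
    · intro j _ hj
      have : pochhammerSymbol (-((0 : ℕ) : ℚ)) j = 0 :=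
        pochhammerSymbol_eq_zero (i := 0) (by simp) (Nat.pos_of_ne_zero hj)
      simp [saalschutzTerm] at this ⊢
      simp [this]
    · simp
  | succ k ih =>
    intro hk
    have h := saalschutzTerm_telescope x w k n hw
    -- Since k < n, the boundary term contains (-k)_n = 0.
    rw [pochhammerSymbol_eq_zero (i := k) (by ring) (by omega), sum_sub_distrib, ← mul_sum,
      ← mul_sum, ih (by omega)] at h
    have h1 : shiftedSqProd w (k + 1) ≠ 0 := (hw (k + 1)).resolve_right (by omega)
    rw [shiftedSqProd_succ] at h1 ⊢
    have h2 := left_ne_zero_of_mul h1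
    have h3 := right_ne_zero_of_mul h1
    rw [eq_div_iff h1]
    rw [shiftedSqPochhammer_succ]
    simp only [zero_mul, zero_div, mul_zero] at h
    field_simp at h
    linear_combination h

/-- For fixed j the summand has a closed indefinite sum in k, which is why Whipple's transformation
survives truncation at any n. -/
lemma alternating_pochhammerSymbol_sum (x : ℚ) (j n : ℕ) :
    ∑ k ∈ range (n + 1), (-1) ^ k * (2 * k + x) * (pochhammerSymbol x k / k.factorial) *
        (pochhammerSymbol (-k) j * pochhammerSymbol (x + k) j) =
      (-1) ^ n * (pochhammerSymbol x (n + 1) / n.factorial) *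
        (pochhammerSymbol (-n) j * pochhammerSymbol (x + n + 1) j) := by
  induction n with
  | zero =>
    rcases j with _ | j
    · simp [pochhammerSymbol_zero, pochhammerSymbol_succ]
    · simp [pochhammerSymbol_eq_zero (x := 0) (i := 0) (k := j + 1)]
  | succ n ih =>
    rw [sum_range_succ, ih]
    have h4 : (n.factorial : ℚ) ≠ 0 := by exact_mod_cast n.factorial_ne_zero
    have h5 : (n : ℚ) + 1 ≠ 0 := by positivity
    have e1 : ((n : ℚ) + 1) * pochhammerSymbol (-n) j =
        (n + 1 - j) * pochhammerSymbol (-((n + 1 : ℕ) : ℚ)) j := by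
      have := pochhammerSymbol_shift (-((n + 1 : ℕ) : ℚ)) j
      rw [show -((n + 1 : ℕ) : ℚ) + 1 = -n by push_cast; ring] at this
      push_cast at this ⊢
      linear_combination -this
    have e2 := pochhammerSymbol_shift (x + ((n + 1 : ℕ) : ℚ)) j
    rw [Nat.factorial_succ, pochhammerSymbol_succ x (n + 1), pow_succ]
    have e3 : x + (n : ℚ) + 1 = x + ((n + 1 : ℕ) : ℚ) := by push_cast; ring
    rw [e3]
    generalize pochhammerSymbol (x + ((n + 1 : ℕ) : ℚ)) j = b at *
    generalize pochhammerSymbol (x + ((n + 1 : ℕ) : ℚ) + 1) j = b' at *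
    generalize pochhammerSymbol (-((n + 1 : ℕ) : ℚ)) j = a at *
    generalize pochhammerSymbol (-(n : ℚ)) j = a' at *
    push_cast at *
    field_simp
    linear_combination pochhammerSymbol x (n + 1) * (b * e1 + a * e2)

/-- The terminating `₃F₂` dual to the truncated well-poised series. -/
def dualSum (x w : ℚ) (n : ℕ) : ℚ :=
  ∑ j ∈ range (n + 1), pochhammerSymbol (1 - x) j * pochhammerSymbol (x + n + 1) j *
    pochhammerSymbol (-n) j / (j.factorial * shiftedSqProd w j)

/-- The truncated very-well-poised series. -/
def wellPoisedSum (x w : ℚ) (n : ℕ) : ℚ :=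
  ∑ k ∈ range (n + 1), (-1) ^ k * (2 * k + x) * (pochhammerSymbol x k / k.factorial) *
    (shiftedSqPochhammer x w k / shiftedSqProd w k)

/-- Whipple's transformation of a truncated very-well-poised series. -/
lemma wellPoisedSum_eq (x w : ℚ) (n : ℕ) (hw : ∀ i : ℕ, shiftedSqProd w i ≠ 0 ∨ n < i) :
    wellPoisedSum x w n =
      (-1) ^ n * (pochhammerSymbol x (n + 1) / n.factorial) * dualSum x w n := by
  have h1 : wellPoisedSum x w n = ∑ k ∈ range (n + 1), ∑ j ∈ range (n + 1),
      (-1) ^ k * (2 * k + x) * (pochhammerSymbol x k / k.factorial) * saalschutzTerm x w k j := by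
    refine sum_congr rfl fun k hk => ?_
    rw [← mul_sum, saalschutz_sum x w n hw k (by simpa [Nat.lt_succ_iff] using hk)]
  rw [h1, sum_comm, dualSum, mul_sum]
  refine sum_congr rfl fun j _ => ?_
  have h2 := congrArg (fun z => z * (pochhammerSymbol (1 - x) j /
    (j.factorial * shiftedSqProd w j))) (alternating_pochhammerSymbol_sum x j n)
  simp only [sum_mul] at h2
  convert h2 using 1
  · refine sum_congr rfl fun k _ => ?_
    rw [saalschutzTerm]
    ring
  · ring

/-- Evaluation of the very-well-poised series when it terminates. -/
lemma wellPoisedSum_sq {x t : ℚ} {m n : ℕ} (ht : x + m = t) (hmn : m ≤ n)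
    (hw : ∀ i : ℕ, shiftedSqProd (t ^ 2) i ≠ 0 ∨ n < i) :
    wellPoisedSum x (t ^ 2) n = (-1) ^ m * t := by
  have h1 : wellPoisedSum x (t ^ 2) n = wellPoisedSum x (t ^ 2) m := by
    refine (sum_subset (range_mono (by omega)) fun k _ hk => ?_).symm
    rw [shiftedSqPochhammer_eq_zero ht (by simpa using hk)]
    simp
  have hw' : ∀ i ≤ m, pochhammerSymbol (1 - t) i ≠ 0 ∧ pochhammerSymbol (1 + t) i ≠ 0 := by
    intro i hi
    have := (hw i).resolve_right (by omega)
    rw [shiftedSqProd_sq] at this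
    exact ⟨left_ne_zero_of_mul this, right_ne_zero_of_mul this⟩
  have hm0 : (m.factorial : ℚ) ≠ 0 := by exact_mod_cast m.factorial_ne_zero
  -- Here x + m + 1 = 1 + t cancels half of the denominator (1-t)_j (1+t)_j, so the ₃F₂ collapses to
  -- a Chu–Vandermonde sum with parameters 1 - x and x.
  have h2 : pochhammerSymbol (1 - t) m * dualSum x (t ^ 2) m = (-1) ^ m * m.factorial := by
    have hv := pochhammerSymbol_vandermonde (1 - x) x m
    rw [show 1 - x + x = (1 : ℚ) by ring, pochhammerSymbol_one, div_self hm0] at hv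
    have key : pochhammerSymbol (1 - t) m * dualSum x (t ^ 2) m =
        (-1) ^ m * m.factorial * ∑ i ∈ range (m + 1), pochhammerSymbol (1 - x) i / i.factorial *
          (pochhammerSymbol x (m - i) / (m - i).factorial) := by
      rw [dualSum, mul_sum, mul_sum]
      refine sum_congr rfl fun j hj => ?_
      have hj' : j ≤ m := by simpa [Nat.lt_succ_iff] using hj
      obtain ⟨ha, hb⟩ := hw' j hj'
      have hj0 : (j.factorial : ℚ) ≠ 0 := by exact_mod_cast j.factorial_ne_zero
      have hmj : ((m - j).factorial : ℚ) ≠ 0 := by exact_mod_cast (m - j).factorial_ne_zero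
      have e1 := pochhammerSymbol_neg_mul_factorial hj'
      have e2 : pochhammerSymbol (1 - t) m = pochhammerSymbol (1 - t) j *
          ((-1) ^ (m - j) * pochhammerSymbol x (m - j)) := by
        conv_lhs => rw [show m = j + (m - j) by omega, pochhammerSymbol_add,
          pochhammerSymbol_reflect (1 - t + j)]
        rw [show 1 - (1 - t + (j : ℚ)) - ((m - j : ℕ) : ℚ) = x by
          rw [Nat.cast_sub hj', ← ht]; ring]
      have e3 : (-1 : ℚ) ^ m = (-1) ^ (m - j) * (-1) ^ j := by
        rw [← pow_add, Nat.sub_add_cancel hj']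
      rw [shiftedSqProd_sq, show x + (m : ℚ) + 1 = 1 + t by rw [← ht]; ring, e2, e3]
      field_simp
      linear_combination pochhammerSymbol x (m - j) * pochhammerSymbol (1 - x) j * e1
    rw [key, ← hv, mul_one]
  have h3 : pochhammerSymbol x (m + 1) = t * ((-1) ^ m * pochhammerSymbol (1 - t) m) := by
    rw [pochhammerSymbol_succ, pochhammerSymbol_reflect, show 1 - x - (m : ℚ) = 1 - t by
      rw [← ht]; ring, ht]
    ring
  have h4 : (-1 : ℚ) ^ m * (-1) ^ m = 1 := by
    rw [← mul_pow]
    norm_num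
  rw [h1, wellPoisedSum_eq x _ m fun i => (hw i).elim Or.inl fun h => Or.inr (by omega), h3]
  field_simp
  linear_combination (t * (-1) ^ m) * h2 + (m.factorial * t) * h4

/-! ### Legendre coefficients and their harmonic sums -/

/-- The summand `(-1)^j C(m, j) C(m + j, j)`. -/
def legendreCoeff (m j : ℕ) : ℚ :=
  pochhammerSymbol (-m) j / j.factorial * (pochhammerSymbol (1 + m) j / j.factorial)

/-- The harmonic number of order two. -/
def harmonicTwo (j : ℕ) : ℚ :=
  ∑ i ∈ range j, 1 / ((i : ℚ) + 1) ^ 2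

lemma legendreCoeff_zero (m : ℕ) : legendreCoeff m 0 = 1 := by
  simp [legendreCoeff, pochhammerSymbol_zero]

lemma legendreCoeff_succ (m j : ℕ) :
    legendreCoeff m (j + 1) =
      legendreCoeff m j * ((j - m) * (1 + m + j)) / ((j : ℚ) + 1) ^ 2 := by
  have h4 : (j.factorial : ℚ) ≠ 0 := by exact_mod_cast j.factorial_ne_zero
  have h5 : (j : ℚ) + 1 ≠ 0 := by positivity
  simp only [legendreCoeff, pochhammerSymbol_succ, Nat.factorial_succ]
  push_cast
  field_simp
  ring

lemma legendreCoeff_eq_zero {m j : ℕ} (h : m < j) : legendreCoeff m j = 0 := by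
  simp [legendreCoeff, pochhammerSymbol_eq_zero (x := -(m : ℚ)) (i := m) (by ring) h]

lemma legendreCoeff_contiguous (m j : ℕ) :
    ((m : ℚ) + 1 + j) * legendreCoeff m j = (m + 1 - j) * legendreCoeff (m + 1) j := by
  induction j with
  | zero => simp [legendreCoeff_zero]
  | succ j ih =>
    have h5 : (j : ℚ) + 1 ≠ 0 := by positivity
    rw [legendreCoeff_succ, legendreCoeff_succ]
    push_cast
    field_simp
    linear_combination ((j : ℚ) - m) * (m + 1 + (j + 1)) * ih

/-- The antidifference has a factor that vanishes for n > m + 1, so the full coefficient sums for m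
and m + 1 are opposite. -/
lemma legendreCoeff_add_sum (m n : ℕ) :
    ∑ j ∈ range n, (legendreCoeff (m + 1) j + legendreCoeff m j) =
      legendreCoeff (m + 1) n * (-2 * (n : ℚ) ^ 2 / ((m + 1) * (m + 1 + n))) := by
  induction n with
  | zero => simp
  | succ n ih =>
    have h5 : (n : ℚ) + 1 ≠ 0 := by positivity
    have h6 : (m : ℚ) + 1 ≠ 0 := by positivity
    have h7 : (m : ℚ) + 1 + n ≠ 0 := by positivity
    have h8 : (m : ℚ) + 1 + (n + 1) ≠ 0 := by positivity
    have h9 : legendreCoeff m n = (m + 1 - n) * legendreCoeff (m + 1) n / (m + 1 + n) := by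
      rw [eq_div_iff h7, ← legendreCoeff_contiguous]
      ring
    rw [sum_range_succ, ih, legendreCoeff_succ, h9]
    push_cast
    field_simp
    ring

/-- Summation by parts against the preceding antidifference; the leftover sum telescopes again. Once
n > m only -2/(m+1)^2 survives, which drives the induction on m. -/
lemma legendreCoeff_add_harmonic_sum (m n : ℕ) :
    ∑ j ∈ range (n + 1), (legendreCoeff (m + 1) j + legendreCoeff m j) * harmonicTwo j =
      legendreCoeff (m + 1) (n + 1) * (-2 * ((n + 1 : ℕ) : ℚ) ^ 2 /
        ((m + 1) * (m + 1 + (n + 1 : ℕ)))) * (harmonicTwo n + 1 / ((m : ℚ) + 1) ^ 2) -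
        2 / ((m : ℚ) + 1) ^ 2 := by
  induction n with
  | zero =>
    have h6 : (m : ℚ) + 1 ≠ 0 := by positivity
    have h8 : (m : ℚ) + 1 + 1 ≠ 0 := by positivity
    simp [harmonicTwo, legendreCoeff_succ, legendreCoeff_zero]
    field_simp
    ring
  | succ n ih =>
    have h5 : (n : ℚ) + 1 ≠ 0 := by positivity
    have h5' : (n : ℚ) + 1 + 1 ≠ 0 := by positivity
    have h6 : (m : ℚ) + 1 ≠ 0 := by positivity
    have h7 : (m : ℚ) + 1 + (n + 1) ≠ 0 := by positivity
    have h8 : (m : ℚ) + 1 + (n + 1 + 1) ≠ 0 := by positivity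
    have h9 : legendreCoeff m (n + 1) =
        (m + 1 - (n + 1)) * legendreCoeff (m + 1) (n + 1) / (m + 1 + (n + 1)) := by
      rw [eq_div_iff h7]
      have := legendreCoeff_contiguous m (n + 1)
      push_cast at this
      linear_combination this
    have h10 : harmonicTwo (n + 1) = harmonicTwo n + 1 / ((n : ℚ) + 1) ^ 2 := by
      simp [harmonicTwo, sum_range_succ]
    rw [sum_range_succ, ih, legendreCoeff_succ (m + 1) (n + 1), h9, h10]
    push_cast
    field_simp
    ring

/-- This is the Legendre polynomial value P_m(-1). -/
lemma legendreCoeff_sum (m : ℕ) : ∀ n, m ≤ n →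
    ∑ j ∈ range (n + 1), legendreCoeff m j = (-1) ^ m := by
  induction m with
  | zero =>
    intro n _
    rw [sum_range_succ', legendreCoeff_zero,
      sum_eq_zero fun j _ => legendreCoeff_eq_zero (Nat.succ_pos j)]
    simp
  | succ m ih =>
    intro n hn
    have h := legendreCoeff_add_sum m (n + 1)
    rw [legendreCoeff_eq_zero (m := m + 1) (by omega), sum_add_distrib, ih n (by omega)] at h
    rw [pow_succ]
    linear_combination h

lemma legendreCoeff_harmonic_sum (m : ℕ) : ∀ n, m ≤ n →
    ∑ j ∈ range (n + 1), legendreCoeff m j * harmonicTwo j =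
      -2 * (-1) ^ m * ∑ k ∈ Icc 1 m, (-1) ^ k / (k : ℚ) ^ 2 := by
  induction m with
  | zero =>
    intro n _
    rw [sum_range_succ', sum_eq_zero fun j _ => by
      rw [legendreCoeff_eq_zero (Nat.succ_pos j), zero_mul]]
    simp [harmonicTwo]
  | succ m ih =>
    intro n hn
    have h := legendreCoeff_add_harmonic_sum m n
    simp only [add_mul] at h
    rw [legendreCoeff_eq_zero (m := m + 1) (by omega), sum_add_distrib, ih n (by omega)] at h
    rw [sum_Icc_succ_top (by omega), pow_succ]
    have h4 : (-1 : ℚ) ^ m * (-1) ^ m = 1 := by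
      rw [← mul_pow]
      norm_num
    push_cast
    linear_combination h + 2 / ((m : ℚ) + 1) ^ 2 * h4

/-! ### Divisibility in the localisation at p -/

/-- The rational number `x` is divisible by `p ^ N` in the localisation of `ℤ` at `p`. -/
def PadicDvd (p N : ℕ) [Fact p.Prime] (x : ℚ) : Prop :=
  ‖(x : ℚ_[p])‖ ≤ (p : ℝ) ^ (-(N : ℤ))

namespace PadicDvd

variable {p : ℕ} [hp : Fact p.Prime] {N K : ℕ} {x y : ℚ}

lemma zero : PadicDvd p N 0 := by
  simp only [PadicDvd, Rat.cast_zero, norm_zero]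
  positivity

lemma add (hx : PadicDvd p N x) (hy : PadicDvd p N y) : PadicDvd p N (x + y) := by
  unfold PadicDvd at *
  rw [Rat.cast_add]
  exact (IsUltrametricDist.norm_add_le_max _ _).trans (max_le hx hy)

lemma neg (hx : PadicDvd p N x) : PadicDvd p N (-x) := by
  unfold PadicDvd at *
  rwa [Rat.cast_neg, norm_neg]

lemma sub (hx : PadicDvd p N x) (hy : PadicDvd p N y) : PadicDvd p N (x - y) := by
  rw [sub_eq_add_neg]
  exact hx.add hy.neg

lemma mul (hx : PadicDvd p N x) (hy : PadicDvd p K y) : PadicDvd p (N + K) (x * y) := by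
  unfold PadicDvd at *
  have hp0 : (p : ℝ) ≠ 0 := by exact_mod_cast hp.out.ne_zero
  rw [Rat.cast_mul, norm_mul, Nat.cast_add, neg_add, zpow_add₀ hp0]
  exact mul_le_mul hx hy (norm_nonneg _) (by positivity)

lemma mono (h : K ≤ N) (hx : PadicDvd p N x) : PadicDvd p K x := by
  unfold PadicDvd at *
  refine hx.trans (zpow_le_zpow_right₀ ?_ (by omega))
  exact_mod_cast hp.out.one_lt.le

lemma mul_left (hx : PadicDvd p N x) (hy : PadicDvd p 0 y) : PadicDvd p N (x * y) := hx.mul hy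

lemma mul_right (hx : PadicDvd p 0 x) (hy : PadicDvd p N y) : PadicDvd p N (x * y) := by
  rw [mul_comm]
  exact hy.mul hx

lemma sum {ι : Type*} {s : Finset ι} {f : ι → ℚ} (h : ∀ i ∈ s, PadicDvd p N (f i)) :
    PadicDvd p N (∑ i ∈ s, f i) :=
  sum_induction f (PadicDvd p N) (fun _ _ => add) zero h

lemma zero_iff : PadicDvd p 0 x ↔ ‖(x : ℚ_[p])‖ ≤ 1 := by simp [PadicDvd]

lemma intCast (k : ℤ) : PadicDvd p 0 k := by
  rw [zero_iff, Rat.cast_intCast]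
  exact Padic.norm_int_le_one k

lemma natCast (k : ℕ) : PadicDvd p 0 k := by
  simpa using intCast (p := p) (k : ℤ)

lemma one : PadicDvd p 0 1 := by simpa using natCast (p := p) 1

lemma neg_one_pow (k : ℕ) : PadicDvd p 0 ((-1) ^ k) := by
  simpa using intCast (p := p) ((-1) ^ k)

lemma natCast_iff {k : ℕ} : PadicDvd p N k ↔ p ^ N ∣ k := by
  have h := Padic.norm_int_le_pow_iff_dvd (p := p) (k : ℤ) N
  rw [PadicDvd, Rat.cast_natCast, ← Int.natCast_dvd_natCast]
  push_cast at h ⊢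
  exact h

lemma of_norm_lt_one (h : ‖(x : ℚ_[p])‖ < 1) : PadicDvd p 1 x := by
  unfold PadicDvd
  rw [Padic.norm_le_pow_iff_norm_lt_pow_add_one]
  simpa using h

lemma norm_lt_one (h : PadicDvd p 1 x) : ‖(x : ℚ_[p])‖ < 1 := by
  unfold PadicDvd at h
  rw [Padic.norm_le_pow_iff_norm_lt_pow_add_one] at h
  simpa using h

/-- A rational number congruent modulo `p` to a `p`-adic unit is a `p`-adic unit. -/
lemma norm_eq_one_of_sub {e : ℚ} (he : ‖(e : ℚ_[p])‖ = 1) (h : PadicDvd p 1 (x - e)) :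
    ‖(x : ℚ_[p])‖ = 1 := by
  have h1 := h.norm_lt_one
  rw [Rat.cast_sub, ← he] at h1
  rw [← he]
  have h2 : ‖(x : ℚ_[p]) - e + e‖ = ‖(e : ℚ_[p])‖ := by
    rw [Padic.add_eq_max_of_ne h1.ne, max_eq_right h1.le]
  simpa using h2

lemma inv (h : ‖(x : ℚ_[p])‖ = 1) : PadicDvd p 0 x⁻¹ := by
  rw [zero_iff, Rat.cast_inv, norm_inv, h, inv_one]

/-- A multiple of `p ^ s` divided by a positive integer below `p ^ s` is a multiple of `p`. -/
lemma div_natCast (hx : PadicDvd p N x) {i : ℕ} (hi : 0 < i) (hiN : i < p ^ N) :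
    PadicDvd p 1 (x / i) := by
  refine of_norm_lt_one ?_
  have h1 : ¬ PadicDvd p N (i : ℚ) := by
    rw [natCast_iff]
    exact Nat.not_dvd_of_pos_of_lt hi hiN
  unfold PadicDvd at h1 hx
  rw [not_le] at h1
  have h2 : 0 < ‖((i : ℚ) : ℚ_[p])‖ := lt_of_le_of_lt (by positivity) h1
  rw [Rat.cast_div, norm_div, div_lt_one h2]
  exact hx.trans_lt h1

/-- Generalised binomial coefficients of `p`-integral rationals are `p`-integral. -/
lemma pochhammerSymbol_div_factorial (hx : PadicDvd p 0 x) (k : ℕ) :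
    PadicDvd p 0 (pochhammerSymbol x k / k.factorial) := by
  rw [zero_iff] at hx ⊢
  obtain ⟨z, hz⟩ : ∃ z : ℤ_[p], (z : ℚ_[p]) = x := ⟨⟨x, hx⟩, rfl⟩
  have h1 := PadicInt.norm_ascPochhammer_le k z
  have h2 : ((pochhammerSymbol x k : ℚ) : ℚ_[p]) =
      (((ascPochhammer ℤ_[p] k).eval z : ℤ_[p]) : ℚ_[p]) := by
    clear h1
    induction k with
    | zero => simp [pochhammerSymbol_zero]
    | succ k ih =>
      rw [pochhammerSymbol_succ, ascPochhammer_succ_eval, Rat.cast_mul, ih]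
      push_cast
      rw [hz]
  have hk : (k.factorial : ℚ_[p]) ≠ 0 := by exact_mod_cast k.factorial_ne_zero
  rw [Rat.cast_div, Rat.cast_natCast, norm_div, div_le_one (norm_pos_iff.2 hk), h2,
    ← PadicInt.coe_natCast, ← PadicInt.norm_def, ← PadicInt.norm_def]
  exact h1

lemma pochhammerSymbol_div_factorial_of_pos (hx : PadicDvd p N x) {k : ℕ} (hk : 0 < k)
    (hkN : k < p ^ N) : PadicDvd p 1 (pochhammerSymbol x k / k.factorial) := by
  obtain ⟨j, rfl⟩ : ∃ j, k = j + 1 := ⟨k - 1, by omega⟩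
  have h1 : pochhammerSymbol x (j + 1) / (j + 1).factorial =
      x / ((j + 1 : ℕ) : ℚ) * (pochhammerSymbol (x + 1) j / j.factorial) := by
    rw [pochhammerSymbol_succ_left, Nat.factorial_succ, Nat.cast_mul, mul_div_mul_comm]
  rw [h1]
  refine (hx.div_natCast hk hkN).mul_left (pochhammerSymbol_div_factorial ?_ j)
  exact (hx.mono (Nat.zero_le _)).add one

/-- Generalised binomial coefficients of lower index below `p ^ N` are periodic modulo `p` with
period `p ^ N`. -/
lemma pochhammerSymbol_div_factorial_congr (hy : PadicDvd p 0 y) (h : PadicDvd p N (x - y))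
    {k : ℕ} (hk : k < p ^ N) :
    PadicDvd p 1 (pochhammerSymbol x k / k.factorial - pochhammerSymbol y k / k.factorial) := by
  -- In the Vandermonde expansion the i = 0 term is the coefficient at y; every other term carries
  -- (x-y)_i / i! with 0 < i < p^N, a multiple of p.
  rw [show x = x - y + y by ring, pochhammerSymbol_vandermonde, sum_range_succ']
  simp only [pochhammerSymbol_zero, Nat.factorial_zero, Nat.cast_one, div_one, one_mul,
    Nat.sub_zero, add_sub_cancel_right]
  refine sum fun i hi => ?_
  have := mem_range.1 hi
  exact (h.pochhammerSymbol_div_factorial_of_pos (Nat.succ_pos i) (by omega)).mul_left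
    (hy.pochhammerSymbol_div_factorial _)

lemma mul_sub_mul {a b a' b' : ℚ} (ha : PadicDvd p N (a - a')) (hb : PadicDvd p N (b - b'))
    (hb0 : PadicDvd p 0 b) (ha0 : PadicDvd p 0 a') : PadicDvd p N (a * b - a' * b') := by
  rw [show a * b - a' * b' = (a - a') * b + a' * (b - b') by ring]
  exact (ha.mul_left hb0).add (ha0.mul_right hb)

lemma sq_mul_harmonicTwo (hx : PadicDvd p N x) {j : ℕ} (hj : j < p ^ N) :
    PadicDvd p 2 (x ^ 2 * harmonicTwo j) := by
  rw [harmonicTwo, mul_sum]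
  refine sum fun i hi => ?_
  have hi' := mem_range.1 hi
  have h1 := hx.div_natCast (Nat.succ_pos i) (by omega)
  have h2 := h1.mul h1
  convert h2 using 1
  push_cast
  rw [div_mul_div_comm, ← sq, ← sq, mul_one_div]

/-- Expansion of `∏ (1 - x² / i²)⁻¹` to second order. -/
lemma factorial_sq_div_shiftedSqProd (hx : PadicDvd p N x) {j : ℕ} (hj : j < p ^ N) :
    shiftedSqProd (x ^ 2) j ≠ 0 ∧
      PadicDvd p 3 ((j.factorial : ℚ) ^ 2 / shiftedSqProd (x ^ 2) j -
        (1 + x ^ 2 * harmonicTwo j)) := by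
  induction j with
  | zero =>
    simpa [shiftedSqProd_zero_right, harmonicTwo] using zero (p := p) (N := 3)
  | succ j ih =>
    obtain ⟨ih1, ih2⟩ := ih (by omega)
    have h1 := hx.div_natCast (Nat.succ_pos j) hj
    have h2 := hx.sq_mul_harmonicTwo (j := j) (by omega)
    push_cast at h1
    have hj0 : (j : ℚ) + 1 ≠ 0 := by positivity
    obtain ⟨a, ha⟩ : ∃ a, a = (x / ((j : ℚ) + 1)) ^ 2 := ⟨_, rfl⟩
    have ha2 : PadicDvd p 2 a := by
      rw [ha, sq]
      exact h1.mul h1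
    have hu : ‖((1 - a : ℚ) : ℚ_[p])‖ = 1 := by
      refine norm_eq_one_of_sub (e := 1) (by simp) ?_
      rw [show 1 - a - 1 = -a by ring]
      exact (ha2.mono (by norm_num)).neg
    have hu0 : 1 - a ≠ 0 := by
      intro h0
      rw [h0] at hu
      simp at hu
    have hinv := inv hu
    have e1 : ((j : ℚ) + 1) ^ 2 - x ^ 2 = (j + 1) ^ 2 * (1 - a) := by
      rw [ha]
      field_simp
    have e2 : harmonicTwo (j + 1) = harmonicTwo j + 1 / ((j : ℚ) + 1) ^ 2 := by
      simp [harmonicTwo, sum_range_succ]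
    have e3 : x ^ 2 * harmonicTwo (j + 1) = x ^ 2 * harmonicTwo j + a := by
      rw [e2, ha, mul_add, div_pow, mul_one_div]
    rw [shiftedSqProd_succ, e1, e3, Nat.factorial_succ]
    refine ⟨mul_ne_zero ih1 (mul_ne_zero (pow_ne_zero 2 hj0) hu0), ?_⟩
    -- With a = x^2/(j+1)^2, the new errors are a^2/(1-a), the tail of the geometric series, and the
    -- cross term with the earlier harmonic sum; both are multiples of p^4.
    have e4 : (((j + 1) * j.factorial : ℕ) : ℚ) ^ 2 /
          (shiftedSqProd (x ^ 2) j * ((j + 1) ^ 2 * (1 - a))) -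
          (1 + (x ^ 2 * harmonicTwo j + a)) =
        ((j.factorial : ℚ) ^ 2 / shiftedSqProd (x ^ 2) j - (1 + x ^ 2 * harmonicTwo j)) *
          (1 - a)⁻¹ + (a * a * (1 - a)⁻¹ + x ^ 2 * harmonicTwo j * (a * (1 - a)⁻¹)) := by
      push_cast
      field_simp
      ring
    rw [e4]
    refine (ih2.mul_left hinv).add (add ?_ ?_)
    · exact ((ha2.mul ha2).mono (by norm_num)).mul_left hinv
    · exact (h2.mul (ha2.mul_left hinv)).mono (by norm_num)

end PadicDvd

lemma ratModEq_iff {p : ℕ} [hp : Fact p.Prime] {N : ℕ} {x y : ℚ} :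
    RatModEq p N x y ↔ PadicDvd p N (x - y) := by
  have hp0 : (p : ℚ) ^ N ≠ 0 := pow_ne_zero _ (by exact_mod_cast hp.out.ne_zero)
  have hpN : PadicDvd p N ((p : ℚ) ^ N) := by
    have := (PadicDvd.natCast_iff (p := p) (N := N) (k := p ^ N)).2 dvd_rfl
    simpa using this
  constructor
  · rintro ⟨z, hz, h⟩
    rw [h]
    exact hpN.mul_left (PadicDvd.zero_iff.2 (Padic.norm_rat_le_one hz))
  · intro h
    refine ⟨(x - y) / p ^ N, fun hd => ?_, by field_simp⟩
    have h1 : ‖(((x - y) / p ^ N : ℚ) : ℚ_[p])‖ ≤ 1 := by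
      unfold PadicDvd at h
      have hp1 : 0 < (p : ℝ) ^ N := pow_pos (by exact_mod_cast hp.out.pos) _
      rw [zpow_neg, zpow_natCast] at h
      rw [Rat.cast_div, norm_div, Rat.cast_pow, Rat.cast_natCast, norm_pow, Padic.norm_p, inv_pow,
        div_le_one (by positivity)]
      exact h
    have h2 := PadicInt.isUnit_den _ h1
    rw [PadicInt.isUnit_iff] at h2
    have h3 := Padic.norm_natCast_lt_one_iff.2 hd
    rw [← PadicInt.coe_natCast, ← PadicInt.norm_def] at h3
    exact h3.ne h2

/-! ### The supercongruence -/

open PadicDvd in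
-- Always 1 - x ≡ 1 + m mod p^s. If n = m then x + n + 1 ≡ 1 and -n = -m; if n + 1 = p^s then x + n
-- + 1 ≡ -m and -n ≡ 1. The last two parameters merely swap roles, so both truncations have the same
-- reduction.
lemma dualSum_term_congr {p s m n j : ℕ} [Fact p.Prime] {x t : ℚ} (ht : x + m = t)
    (hts : PadicDvd p s t) (hn : n = m ∨ n + 1 = p ^ s) (hj : j < p ^ s) :
    PadicDvd p 1 (pochhammerSymbol (1 - x) j / j.factorial *
      (pochhammerSymbol (x + n + 1) j / j.factorial * (pochhammerSymbol (-n) j / j.factorial)) -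
        legendreCoeff m j) := by
  have hx : x = t - m := by rw [← ht]; ring
  have ht0 := hts.mono (Nat.zero_le _)
  have hm : PadicDvd p 0 (m : ℚ) := natCast m
  have hn0 : PadicDvd p 0 (n : ℚ) := natCast n
  have hx0 : PadicDvd p 0 x := by
    rw [hx]
    exact ht0.sub hm
  have hj0 : (j.factorial : ℚ) ≠ 0 := by exact_mod_cast j.factorial_ne_zero
  have h1 : PadicDvd p 1 (pochhammerSymbol 1 j / j.factorial - 1) := by
    rw [pochhammerSymbol_one, div_self hj0, sub_self]
    exact zero
  have hA : PadicDvd p 1 (pochhammerSymbol (1 - x) j / j.factorial -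
      pochhammerSymbol (1 + m) j / j.factorial) := by
    refine pochhammerSymbol_div_factorial_congr (N := s) (one.add hm) ?_ hj
    rw [show 1 - x - (1 + m) = -t by rw [hx]; ring]
    exact hts.neg
  have hB : PadicDvd p 1 (pochhammerSymbol (x + n + 1) j / j.factorial *
      (pochhammerSymbol (-n) j / j.factorial) - pochhammerSymbol (-m) j / j.factorial) := by
    have hint := (hn0.neg).pochhammerSymbol_div_factorial j
    rcases hn with rfl | hn
    · have h2 := pochhammerSymbol_div_factorial_congr (N := s) (x := x + n + 1) one
        (by rw [show x + n + 1 - 1 = t by rw [hx]; ring]; exact hts) hj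
      rw [pochhammerSymbol_one, div_self hj0] at h2
      have := h2.mul_left hint
      rwa [sub_mul, one_mul] at this
    · have hps : PadicDvd p s ((n : ℚ) + 1) := by
        have := (natCast_iff (p := p) (N := s) (k := n + 1)).2 (by rw [hn])
        push_cast at this
        exact this
      have h2 := pochhammerSymbol_div_factorial_congr (N := s) (x := -n) one
        (by rw [show -(n : ℚ) - 1 = -(n + 1) by ring]; exact hps.neg) hj
      rw [pochhammerSymbol_one, div_self hj0] at h2
      have h3 := pochhammerSymbol_div_factorial_congr (N := s) (x := x + n + 1) hm.neg
        (by rw [show x + n + 1 - -(m : ℚ) = t + (n + 1) by rw [hx]; ring]; exact hts.add hps) hj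
      have := mul_sub_mul h3 h2 hint (hm.neg.pochhammerSymbol_div_factorial j)
      rwa [mul_one] at this
  have hfin := mul_sub_mul hA hB
    ((((hx0.add hn0).add one).pochhammerSymbol_div_factorial j).mul_left
      ((hn0.neg).pochhammerSymbol_div_factorial j))
    ((one.add hm).pochhammerSymbol_div_factorial j)
  rwa [legendreCoeff, mul_comm (pochhammerSymbol (-(m : ℚ)) j / _)]

open PadicDvd in
/-- The supercongruence for the truncated very-well-poised series. -/
lemma wellPoisedSum_congr {p s m n : ℕ} [hp : Fact p.Prime] {x t : ℚ} (ht : x + m = t)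
    (hts : PadicDvd p s t) (hmn : m ≤ n) (hns : n < p ^ s) (hn : n = m ∨ n + 1 = p ^ s) :
    PadicDvd p (s + 3) (wellPoisedSum x 0 n -
      ((-1) ^ m * t + 2 * (-1) ^ m * t ^ 3 * ∑ k ∈ Icc 1 m, (-1) ^ k / (k : ℚ) ^ 2)) := by
  have hw0 : ∀ i : ℕ, shiftedSqProd 0 i ≠ 0 ∨ n < i := fun i => Or.inl <| by
    rw [shiftedSqProd_zero]
    exact pow_ne_zero 2 (by exact_mod_cast i.factorial_ne_zero)
  have hwt : ∀ i : ℕ, shiftedSqProd (t ^ 2) i ≠ 0 ∨ n < i := fun i => by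
    by_cases hi : n < i
    · exact Or.inr hi
    · exact Or.inl (hts.factorial_sq_div_shiftedSqProd (by omega)).1
  have hS0 := wellPoisedSum_eq x 0 n hw0
  have hSt := wellPoisedSum_eq x (t ^ 2) n hwt
  rw [wellPoisedSum_sq ht hmn hwt] at hSt
  -- The prefactor is divided by t below; if t = 0, it contains the factor x + m = 0 and both sides
  -- vanish.
  by_cases ht0 : t = 0
  · subst ht0
    rw [hS0, pochhammerSymbol_eq_zero ht (Nat.lt_succ_of_le hmn)]
    simpa using PadicDvd.zero
  have hx : x = t - m := by rw [← ht]; ring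
  have hx0 : PadicDvd p 0 x := by
    rw [hx]
    exact (hts.mono (Nat.zero_le _)).sub (natCast m)
  set A : ℕ → ℚ := fun j => pochhammerSymbol (1 - x) j / j.factorial *
    (pochhammerSymbol (x + n + 1) j / j.factorial * (pochhammerSymbol (-n) j / j.factorial))
    with hA
  have hA0 : ∀ j, PadicDvd p 0 (A j) := fun j =>
    ((one.sub hx0).pochhammerSymbol_div_factorial j).mul_left
      ((((hx0.add (natCast n)).add one).pochhammerSymbol_div_factorial j).mul_left
        ((natCast n).neg.pochhammerSymbol_div_factorial j))
  have hAE : ∀ j ∈ range (n + 1), PadicDvd p 1 (A j - legendreCoeff m j) := fun j hj =>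
    dualSum_term_congr ht hts hn (by have := mem_range.1 hj; omega)
  have hR0 : dualSum x 0 n = ∑ j ∈ range (n + 1), A j := by
    refine sum_congr rfl fun j _ => ?_
    have hj0 : (j.factorial : ℚ) ≠ 0 := by exact_mod_cast j.factorial_ne_zero
    rw [shiftedSqProd_zero, hA]
    field_simp
  have hRt : dualSum x (t ^ 2) n = ∑ j ∈ range (n + 1),
      A j * ((j.factorial : ℚ) ^ 2 / shiftedSqProd (t ^ 2) j) := by
    refine sum_congr rfl fun j hj => ?_
    have hj0 : (j.factorial : ℚ) ≠ 0 := by exact_mod_cast j.factorial_ne_zero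
    have := (hwt j).resolve_right (by have := mem_range.1 hj; omega)
    simp only [hA]
    field_simp
  set H : ℚ := ∑ j ∈ range (n + 1), legendreCoeff m j * harmonicTwo j with hH
  have hharm : ∀ j ∈ range (n + 1), PadicDvd p 2 (t ^ 2 * harmonicTwo j) := fun j hj =>
    hts.sq_mul_harmonicTwo (by have := mem_range.1 hj; omega)
  have hE0 : ∀ j, PadicDvd p 0 (legendreCoeff m j) := fun j =>
    ((natCast m).neg.pochhammerSymbol_div_factorial j).mul_left
      ((one.add (natCast m)).pochhammerSymbol_div_factorial j)
  have hH2 : PadicDvd p 2 (t ^ 2 * H) := by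
    rw [hH, mul_sum]
    refine sum fun j hj => ?_
    rw [mul_left_comm]
    exact (hE0 j).mul_right (hharm j hj)
  have hdiff : PadicDvd p 3 (dualSum x (t ^ 2) n - dualSum x 0 n - t ^ 2 * H) := by
    rw [hRt, hR0, hH, mul_sum, ← sum_sub_distrib, ← sum_sub_distrib]
    refine sum fun j hj => ?_
    have h1 := (hts.factorial_sq_div_shiftedSqProd (j := j)
      (by have := mem_range.1 hj; omega)).2
    -- The error splits as A_j times the third-order remainder, plus (A_j - E(m,j)) times t^2 H_j:
    -- the factors p and p^2 combine to p^3.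
    have h2 := ((hA0 j).mul_right h1).add ((hAE j hj).mul (hharm j hj))
    convert h2 using 1
    ring
  have hdiff2 : PadicDvd p 2 (dualSum x (t ^ 2) n - dualSum x 0 n) := by
    have := (hdiff.mono (K := 2) (by norm_num)).add hH2
    simpa using this
  have hR0' : PadicDvd p 1 (dualSum x 0 n - (-1) ^ m) := by
    rw [hR0, ← legendreCoeff_sum m n hmn, ← sum_sub_distrib]
    exact sum hAE
  have hRt' : PadicDvd p 1 (dualSum x (t ^ 2) n - (-1) ^ m) := by
    have := (hdiff2.mono (K := 1) (by norm_num)).add hR0'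
    simpa using this
  have hunit : ‖((dualSum x (t ^ 2) n : ℚ) : ℚ_[p])‖ = 1 :=
    norm_eq_one_of_sub (by simp) hRt'
  obtain ⟨c, hc⟩ : ∃ c, c = (-1) ^ n * (pochhammerSymbol x (n + 1) / n.factorial) / t := ⟨_, rfl⟩
  have hct : (-1) ^ n * (pochhammerSymbol x (n + 1) / n.factorial) = t * c := by
    rw [hc]
    field_simp
  rw [hct] at hS0 hSt
  have hcR : c * dualSum x (t ^ 2) n = (-1) ^ m := by
    refine mul_left_cancel₀ ht0 ?_
    linear_combination -hSt
  have hc0 : PadicDvd p 0 c := by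
    have hne : dualSum x (t ^ 2) n ≠ 0 := by
      intro h0
      rw [h0] at hunit
      simp at hunit
    rw [show c = (-1) ^ m * (dualSum x (t ^ 2) n)⁻¹ by rw [← hcR]; field_simp]
    exact (neg_one_pow m).mul_left (inv hunit)
  have h4 : (-1 : ℚ) ^ m * (-1) ^ m = 1 := by
    rw [← mul_pow]
    norm_num
  have hc1 : PadicDvd p 1 (c - 1) := by
    have := (neg_one_pow m).mul_right (hc0.mul_right hRt')
    convert this.neg using 1
    linear_combination (-1) ^ m * hcR - (c - 1) * h4
  -- The difference equals -t (c (R(t^2) - R(0) - t^2 H) + (c - 1) t^2 H): p^s from t, p^3 from each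
  -- summand.
  have hfin := hts.mul (((hc0.mul_right hdiff).add (hc1.mul hH2)).neg)
  convert hfin using 1
  rw [hS0]
  have hHeq := legendreCoeff_harmonic_sum m n hmn
  rw [← hH] at hHeq
  linear_combination t * hcR - t ^ 3 * hHeq

theorem corollary1p2 (p : ℕ) (hp : p.Prime) (hp3 : 3 < p)
    (s d : ℕ) (hs : 0 < s) (hd : 0 < d) (hpd : ¬ p ∣ d)
    (r : ℤ) (hrd : Int.gcd r (d : ℤ) = 1)
    (m : ℕ) (hm : IsLeastNonnegResidue p s (-(r : ℚ) / (d : ℚ)) m)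
    (M : ℕ) (hM : M = p ^ s - 1 ∨ M = m) :
    RatModEq p (s + 3)
      (∑ k ∈ Finset.range (M + 1),
        (-1 : ℚ) ^ k * (2 * (d : ℚ) * (k : ℚ) + (r : ℚ)) *
          (pochhammerSymbol ((r : ℚ) / (d : ℚ)) k ^ 3 / (k.factorial : ℚ) ^ 3))
      ((-1 : ℚ) ^ m * ((m : ℚ) * (d : ℚ) + (r : ℚ)) +
        2 * (-1 : ℚ) ^ m * ((m : ℚ) * (d : ℚ) + (r : ℚ)) ^ 3 / (d : ℚ) ^ 2 *
          ∑ k ∈ Finset.Icc 1 m, (-1 : ℚ) ^ k / (k : ℚ) ^ 2) := by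
  have : Fact p.Prime := ⟨hp⟩
  have hd0 : (d : ℚ) ≠ 0 := by exact_mod_cast hd.ne'
  have hps : 0 < p ^ s := pow_pos hp.pos s
  have hm1 : PadicDvd p s ((r : ℚ) / d + m) := by
    have := ratModEq_iff.1 hm.1
    convert this using 1
    ring
  have hmlt : m < p ^ s := by
    by_contra! h
    have h1 : m - p ^ s ∈ {j : ℕ | RatModEq p s (j : ℚ) (-(r : ℚ) / (d : ℚ))} := by
      have h2 := ratModEq_iff.1 hm.1
      refine ratModEq_iff.2 ?_
      have h3 := (PadicDvd.natCast_iff (p := p) (N := s) (k := p ^ s)).2 dvd_rfl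
      convert h2.sub h3 using 1
      rw [Nat.cast_sub h]
      ring
    have := hm.2 h1
    omega
  have key := wellPoisedSum_congr (n := M) rfl hm1 (by omega) (by omega) (by omega)
  rw [ratModEq_iff]
  -- Multiplying by d turns t into md + r and t^3 into (md + r)^3 / d^2.
  convert (PadicDvd.natCast (p := p) d).mul_right key using 1
  rw [mul_sub]
  congr 1
  · rw [wellPoisedSum, mul_sum]
    refine sum_congr rfl fun k _ => ?_
    have hk0 : (k.factorial : ℚ) ≠ 0 := by exact_mod_cast k.factorial_ne_zero
    rw [shiftedSqPochhammer_zero, shiftedSqProd_zero]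
    field_simp
  · field_simp
    ring
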